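/- Let $n\ge 1$, $q\ge 2$, let $M,K\in\mathbb{R}^{n\times n}$ be symmetric positive definite, and for $i,j\in\{1,\dots,q\}$ let $D_{ij},R_{ij}\in\mathbb{R}^{n\times n}$ be symmetric positive semidefinite with $D_{ij}=D_{ji}$, $R_{ij}=R_{ji}$ and $D_{ii}=R_{ii}=0$. Suppose that the roots $\sigma_1,\dots,\sigma_n$ of $s\mapsto\det(sM-K)$, which are the eigenvalues of $P:=M^{-1/2}KM^{-1/2}$, are pairwise distinct; let $v_1,\dots,v_n\in\mathbb{R}^n$ be unit vectors with $Pv_k=\sigma_kv_k$, and put $V=[v_1\ \cdots\ v_n]$, $\Lambda=\mathrm{diag}(\sigma_1,\dots,\sigma_n)$. For a family of weights $(W_{ij})_{i,j=1}^q$ let $\mathrm{lap}(W_{ij})$ be the block matrix with diagonal blocks $\sum_l W_{il}$ and off-diagonal blocks $-W_{ij}$. Put $L_{\rm d}=\mathrm{lap}(M^{-1/2}D_{ij}M^{-1/2})$, $L_{\rm r}=\mathrm{lap}(M^{-1/2}R_{ij}M^{-1/2})$, and let $G$ and $B$ be the $qn\times qn$ block matrices whose $q\times q$ blocks, for $k,\ell=1,\dots,n$,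 are $$G_{k\ell}=[I_q\otimes v_k^T]L_{\rm d}[I_q\otimes v_\ell],\qquad B_{k\ell}=[I_q\otimes v_k^T]L_{\rm r}[I_q\otimes v_\ell].$$ For $\varepsilon\ge 0$ and $j=\sqrt{-1}$ put $$\Gamma_\varepsilon=L_{\rm d}+j\bigl([I_q\otimes P]+\varepsilon L_{\rm r}\bigr),\qquad \Omega_\varepsilon=G+j\bigl([\Lambda\otimes I_q]+\varepsilon B\bigr).$$ Let $\Pi$ be the permutation matrix with $\Pi^T[X\otimes Y]\Pi=Y\otimes X$ for all $X\in\mathbb{R}^{q\times q}$, $Y\in\mathbb{R}^{n\times n}$. Then $[I_q\otimes V]\Pi$ is orthogonal and $\Omega_\varepsilon=\Pi^T[I_q\otimes V^T]\,\Gamma_\varepsilon\,[I_q\otimes V]\Pi$. Moreover, for every $\varepsilon\ge 0$, the array $$M\ddot x_i+Kx_i+\sum_{j=1}^qD_{ij}(\dot x_i-\dot x_j)+\varepsilon\sum_{j=1}^qR_{ij}(x_i-x_j)=0,\qquad i=1,\dots,q,$$ synchronizes, i.e. every solution satisfies $\|x_i(t)-x_j(t)\|\to0$ as $t\to\infty$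 for all $i,j$, if and only if $\mathrm{Re}\,\lambda_{n+1}(\Omega_\varepsilon)>0$, where $\lambda_1(X),\lambda_2(X),\dots$ denote the eigenvalues of a complex square matrix $X$, repeated according to algebraic multiplicity and ordered so that $\mathrm{Re}\,\lambda_1(X)\le\mathrm{Re}\,\lambda_2(X)\le\cdots$. -/

import Mathlib

open scoped Matrix Kronecker

namespace CoupledOsc

/-- Admissible families of coupling matrices: `W i j` is symmetric positive semidefinite,
`W i j = W j i` and `W i i = 0`. (Over the reals, `Matrix.PosSemidef` includes symmetry.) -/
structure IsCoupling {q n : ℕ} (W : Fin q → Fin q → Matrix (Fin n) (Fin n) ℝ) : Prop where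
  posSemidef : ∀ i j, (W i j).PosSemidef
  symm : ∀ i j, W i j = W j i
  diag : ∀ i, W i i = 0

/-- `x : ℝ → (ℝⁿ)^q` is a solution of
`M xᵢ'' + K xᵢ + ∑ⱼ Dᵢⱼ (xᵢ' - xⱼ') + ε ∑ⱼ Rᵢⱼ (xᵢ - xⱼ) = 0`, `i = 1, …, q`;
here `v i = xᵢ'` and `a i = xᵢ''`. -/
def IsSolution {q n : ℕ} (M K : Matrix (Fin n) (Fin n) ℝ)
    (D R : Fin q → Fin q → Matrix (Fin n) (Fin n) ℝ) (ε : ℝ)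
    (x : Fin q → ℝ → (Fin n → ℝ)) : Prop :=
  ∃ v a : Fin q → ℝ → (Fin n → ℝ),
    (∀ i t, HasDerivAt (x i) (v i t) t) ∧
    (∀ i t, HasDerivAt (v i) (a i t) t) ∧
    ∀ i t, M *ᵥ a i t + K *ᵥ x i t + ∑ j, D i j *ᵥ (v i t - v j t)
      + ε • ∑ j, R i j *ᵥ (x i t - x j t) = 0

/-- The array synchronizes: along every solution, `‖xᵢ(t) - xⱼ(t)‖ → 0` (Euclidean norm)
as `t → ∞`, for all `i, j`. -/
def Synchronizes {q n : ℕ} (M K : Matrix (Fin n) (Fin n) ℝ)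
    (D R : Fin q → Fin q → Matrix (Fin n) (Fin n) ℝ) (ε : ℝ) : Prop :=
  ∀ x : Fin q → ℝ → (Fin n → ℝ), IsSolution M K D R ε x →
    ∀ i j, Filter.Tendsto (fun t => ‖WithLp.toLp 2 (x i t - x j t)‖) Filter.atTop (nhds 0)

open scoped MatrixOrder in
/-- `M^{-1/2}`, the inverse of the positive semidefinite square root of `M`. -/
noncomputable def invSqrt {n : ℕ} (M : Matrix (Fin n) (Fin n) ℝ) : Matrix (Fin n) (Fin n) ℝ :=
  (CFC.sqrt M)⁻¹

/-- `P = M^{-1/2} K M^{-1/2}`. -/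
noncomputable def oscP {n : ℕ} (M K : Matrix (Fin n) (Fin n) ℝ) : Matrix (Fin n) (Fin n) ℝ :=
  invSqrt M * K * invSqrt M

/-- The matrix-weighted Laplacian `lap (Wᵢⱼ)`: diagonal blocks `∑ₗ Wᵢₗ`, off-diagonal blocks
`-Wᵢⱼ`. The entry `((i, a), (j, b))` is the entry `(a, b)` of the block `(i, j)`. -/
def lap {q n : ℕ} (W : Fin q → Fin q → Matrix (Fin n) (Fin n) ℝ) :
    Matrix (Fin q × Fin n) (Fin q × Fin n) ℝ :=
  Matrix.of fun r c => if r.1 = c.1 then (∑ l, W r.1 l) r.2 c.2 else -W r.1 c.1 r.2 c.2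

/-- `lap (M^{-1/2} Wᵢⱼ M^{-1/2})`: this is `L_d` for `W = D` and `L_r` for `W = R`. -/
noncomputable def couplingLap {q n : ℕ} (M : Matrix (Fin n) (Fin n) ℝ)
    (W : Fin q → Fin q → Matrix (Fin n) (Fin n) ℝ) :
    Matrix (Fin q × Fin n) (Fin q × Fin n) ℝ :=
  lap fun i j => invSqrt M * W i j * invSqrt M

/-- The `q × q` block `[I_q ⊗ v_kᵀ] L [I_q ⊗ v_ℓ]`. -/
def modalBlock {q n : ℕ} (v : Fin n → Fin n → ℝ)
    (L : Matrix (Fin q × Fin n) (Fin q × Fin n) ℝ) (k l : Fin n) :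
    Matrix (Fin q) (Fin q) ℝ :=
  (((1 : Matrix (Fin q) (Fin q) ℝ) ⊗ₖ Matrix.replicateRow Unit (v k)) * L *
    ((1 : Matrix (Fin q) (Fin q) ℝ) ⊗ₖ Matrix.replicateCol Unit (v l))).submatrix
      (fun i => (i, ())) (fun i => (i, ()))

/-- The `n × n` block matrix with blocks `[I_q ⊗ v_kᵀ] L [I_q ⊗ v_ℓ]`:
this is `G` for `L = L_d` and `B` for `L = L_r`. -/
def modalMatrix {q n : ℕ} (v : Fin n → Fin n → ℝ)
    (L : Matrix (Fin q × Fin n) (Fin q × Fin n) ℝ) :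
    Matrix (Fin n × Fin q) (Fin n × Fin q) ℝ :=
  Matrix.of fun r c => modalBlock v L r.1 c.1 r.2 c.2

/-- `X + jY` for real matrices `X`, `Y`. -/
noncomputable def toComplex {ι : Type*} (X Y : Matrix ι ι ℝ) : Matrix ι ι ℂ :=
  X.map Complex.ofReal + Complex.I • Y.map Complex.ofReal

/-- `Γ_ε = L_d + j([I_q ⊗ P] + ε L_r)`. -/
noncomputable def Gam {q n : ℕ} (M K : Matrix (Fin n) (Fin n) ℝ)
    (D R : Fin q → Fin q → Matrix (Fin n) (Fin n) ℝ) (ε : ℝ) :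
    Matrix (Fin q × Fin n) (Fin q × Fin n) ℂ :=
  toComplex (couplingLap M D)
    ((1 : Matrix (Fin q) (Fin q) ℝ) ⊗ₖ oscP M K + ε • couplingLap M R)

/-- `Ω_ε = G + j([Λ ⊗ I_q] + ε B)`, with `Λ = diag(σ₁, …, σₙ)`. -/
noncomputable def Omg {q n : ℕ} (M : Matrix (Fin n) (Fin n) ℝ)
    (D R : Fin q → Fin q → Matrix (Fin n) (Fin n) ℝ) (ε : ℝ)
    (σ : Fin n → ℝ) (v : Fin n → Fin n → ℝ) :
    Matrix (Fin n × Fin q) (Fin n × Fin q) ℂ :=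
  toComplex (modalMatrix v (couplingLap M D))
    (Matrix.diagonal σ ⊗ₖ (1 : Matrix (Fin q) (Fin q) ℝ) + ε • modalMatrix v (couplingLap M R))

/-- The permutation matrix `Π` that exchanges the two Kronecker factors. -/
def swapMat (q n : ℕ) : Matrix (Fin q × Fin n) (Fin n × Fin q) ℝ :=
  (1 : Matrix (Fin q × Fin n) (Fin q × Fin n) ℝ).submatrix id Prod.swap

theorem swapMat_transpose_mul_kronecker_mul {q n : ℕ} (X : Matrix (Fin q) (Fin q) ℝ)
    (Y : Matrix (Fin n) (Fin n) ℝ) :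
    (swapMat q n)ᵀ * (X ⊗ₖ Y) * swapMat q n = Y ⊗ₖ X := by
  ext ⟨a, i⟩ ⟨b, j⟩
  simp [swapMat, Matrix.mul_apply, Matrix.one_apply, mul_comm]

/-- `[I_q ⊗ V] Π` with `V = [v₁ v₂ ⋯ vₙ]` (the `v_k` are the columns). -/
def simMat {n : ℕ} (q : ℕ) (v : Fin n → Fin n → ℝ) :
    Matrix (Fin q × Fin n) (Fin n × Fin q) ℝ :=
  ((1 : Matrix (Fin q) (Fin q) ℝ) ⊗ₖ (Matrix.of v)ᵀ) * swapMat q n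

/-- `Re λ_k(X)` for `k = 1, 2, …, card ι`: the `k`th smallest among the real parts of the
eigenvalues of `X`, the eigenvalues being counted with algebraic multiplicity.
(The value for other `k` is irrelevant.) -/
noncomputable def reLambda {ι : Type*} [Fintype ι] [DecidableEq ι] (k : ℕ) (X : Matrix ι ι ℂ) :
    ℝ :=
  ((X.charpoly.roots.map Complex.re).sort (· ≤ ·)).getD (k - 1) 0

end CoupledOsc

open CoupledOsc

/-! In the coordinates `zᵢ = M^{1/2} xᵢ` the array reads `z'' + B z' + A z = 0`, where `A = I ⊗ P +
ε L_r` is positive definite and `B = L_d` is positive semidefinite. Call `w` an undamped mode if `B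
w = 0` and `A w = c w`. Both sides of the equivalence say that every undamped mode is synchronous,
i.e. has equal blocks.

Dynamics (`synchronizes_iff`): an undamped mode carries the periodic solution `cos(√c t) w`, so
synchronization forces `w` to be synchronous. Conversely, let `J` be the projection onto synchronous
states. It commutes with `A`, and `BJ = JB = 0`, so `(1 - J) z` is also a motion with damping `B +
J`. If all undamped modes are synchronous, this motion has none left, its quadratic eigenvalues lie
in the open left half plane, and it decays.

Spectrum (`finrank_undampedSpace`): the eigenvalues of `Γ = B + iA` have nonnegative real part.
Those on the imaginary axis are semisimple, and their eigenvectors are exactly the undamped modes.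
Hence the span of these modes has as dimension the number of eigenvalues with `Re ≤ 0`. It contains
the `n`-dimensional synchronous space, and the two agree precisely when `Re λ_{n+1} > 0`. Finally
`Ω` is orthogonally similar to `Γ`, so `Γ` may be replaced by `Ω`. -/

open CoupledOsc
open Filter Topology

section

open scoped ComplexOrder

/-! ### Asymptotic stability of linear systems -/

/-- A stable scalar linear equation driven by a vanishing input has vanishing solutions. -/
theorem tendsto_zero_of_hasDerivAt_smul_add {E : Type*} [NormedAddCommGroup E] [NormedSpace ℂ E]
    {y g : ℝ → E} {μ : ℂ} (hμ : μ.re < 0) (hy : ∀ t, HasDerivAt y (μ • y t + g t) t)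
    (hg : Tendsto g atTop (𝓝 0)) : Tendsto y atTop (𝓝 0) := by
  set a : ℝ := -μ.re with ha
  have ha0 : 0 < a := by linarith
  have hnexp (t : ℝ) : ‖Complex.exp (-(μ * t))‖ = Real.exp (a * t) := by
    rw [Complex.norm_exp]; simp [ha]
  have hu (t : ℝ) : HasDerivAt (fun t : ℝ => Complex.exp (-(μ * t)) • y t)
      (Complex.exp (-(μ * t)) • g t) t := by
    have h1 : HasDerivAt (fun t : ℝ => Complex.exp (-(μ * t)))
        (Complex.exp (-(μ * t)) * -(μ * 1)) t :=
      (((hasDerivAt_id t).ofReal_comp.const_mul μ).neg).cexp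
    convert h1.fun_smul (hy t) using 1
    module
  rw [tendsto_zero_iff_norm_tendsto_zero, Metric.tendsto_atTop]
  intro δ hδ
  -- With input below `a δ / 2` after `T`, the derivative of `exp(-μt) y` is at most `a (δ/2)
  -- exp(at)`, which integrates to `(δ/2) exp(at)`. Undoing the factor leaves `δ/2` plus a decaying
  -- term.
  obtain ⟨T, hT⟩ := Metric.tendsto_atTop.1 hg (a * (δ / 2)) (by positivity)
  have hbound (t : ℝ) (ht : T ≤ t) :
      ‖y t‖ ≤ Real.exp (-(a * t)) * (Real.exp (a * T) * ‖y T‖) + δ / 2 := by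
    have key := image_norm_le_of_norm_deriv_right_le_deriv_boundary (a := T) (b := t)
      (f := fun t : ℝ => Complex.exp (-(μ * t)) • y t)
      (f' := fun t : ℝ => Complex.exp (-(μ * t)) • g t)
      (B := fun t => Real.exp (a * T) * ‖y T‖ + δ / 2 * Real.exp (a * t))
      (B' := fun t => δ / 2 * (Real.exp (a * t) * (a * 1)))
      (fun x _ => (hu x).continuousAt.continuousWithinAt)
      (fun x _ => (hu x).hasDerivWithinAt)
      (by
        simp only [norm_smul, hnexp]
        have := Real.exp_pos (a * T)
        nlinarith)
      (fun x => (((hasDerivAt_id x).const_mul a).exp.const_mul _).const_add _)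
      (fun x hx => by
        rw [norm_smul, hnexp]
        have h1 := (hT x hx.1).le
        rw [dist_zero_right] at h1
        have h2 := Real.exp_pos (a * x)
        nlinarith) (Set.right_mem_Icc.2 ht)
    simp only [norm_smul, hnexp] at key
    have h3 : Real.exp (-(a * t)) * Real.exp (a * t) = 1 := by rw [← Real.exp_add]; simp
    calc ‖y t‖ = Real.exp (-(a * t)) * (Real.exp (a * t) * ‖y t‖) := by
          rw [← mul_assoc, h3, one_mul]
      _ ≤ Real.exp (-(a * t)) *
          (Real.exp (a * T) * ‖y T‖ + δ / 2 * Real.exp (a * t)) := by gcongr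
      _ = _ := by linear_combination (δ / 2) * h3
  have hlim : Tendsto (fun t : ℝ => Real.exp (-(a * t)) * (Real.exp (a * T) * ‖y T‖))
      atTop (𝓝 0) := by
    have h1 : Tendsto (fun t : ℝ => Real.exp (-(a * t))) atTop (𝓝 0) :=
      Real.tendsto_exp_neg_atTop_nhds_zero.comp (tendsto_id.const_mul_atTop ha0)
    simpa using h1.mul_const (Real.exp (a * T) * ‖y T‖)
  obtain ⟨T', hT'⟩ := Metric.tendsto_atTop.1 hlim (δ / 2) (by positivity)
  refine ⟨max T T', fun t ht => ?_⟩
  have h1 := hbound t ((le_max_left _ _).trans ht)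
  have h2 := hT' t ((le_max_right _ _).trans ht)
  rw [dist_zero_right, Real.norm_eq_abs] at h2
  rw [dist_zero_right, norm_norm]
  linarith [(abs_lt.1 h2).2]

theorem HasDerivAt.matrix_mulVec {ι κ 𝔸 : Type*} [Fintype ι] [Fintype κ] [NormedRing 𝔸]
    [NormedAlgebra ℝ 𝔸] (F : Matrix κ ι 𝔸) {X : ℝ → ι → 𝔸} {X' : ι → 𝔸} {t : ℝ}
    (h : HasDerivAt X X' t) : HasDerivAt (fun t => F *ᵥ X t) (F *ᵥ X') t := by
  rw [hasDerivAt_pi] at h ⊢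
  intro i
  exact HasDerivAt.fun_sum fun j _ => (h j).const_mul (F i j)

/-- The factors are peeled off one at a time: if `G` is the product of the remaining ones, then `Y =
G X` solves `Y' = μ Y + (F - μ) G X`, a stable scalar equation whose input vanishes at infinity. -/
theorem tendsto_zero_of_prod_sub_mulVec {ι : Type*} [Fintype ι] [DecidableEq ι]
    {F : Matrix ι ι ℂ} (l : List ℂ) (hl : ∀ μ ∈ l, μ.re < 0) :
    ∀ {X : ℝ → ι → ℂ}, (∀ t, HasDerivAt X (F *ᵥ X t) t) →
      Tendsto (fun t => (l.map fun μ => F - Matrix.scalar ι μ).prod *ᵥ X t) atTop (𝓝 0) →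
      Tendsto X atTop (𝓝 0) := by
  induction l with
  | nil => intro X _ h; simpa using h
  | cons μ l ih =>
    intro X hX h
    refine ih (fun ν hν => hl ν (List.mem_cons_of_mem _ hν)) hX ?_
    set G := (l.map fun μ => F - Matrix.scalar ι μ).prod with hG
    have hcomm : Commute F G := by
      refine Commute.list_prod_right _ _ fun y hy => ?_
      obtain ⟨ν, -, rfl⟩ := List.mem_map.1 hy
      exact (Commute.refl F).sub_right (Matrix.scalar_commute ν (fun _ => mul_comm _ _) F).symm
    refine tendsto_zero_of_hasDerivAt_smul_add (hl μ List.mem_cons_self)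
      (g := fun t => (F - Matrix.scalar ι μ) *ᵥ G *ᵥ X t) (fun t => ?_) ?_
    · have h1 : μ • G *ᵥ X t + (F - Matrix.scalar ι μ) *ᵥ G *ᵥ X t = G *ᵥ F *ᵥ X t := by
        rw [Matrix.sub_mulVec, Matrix.scalar_apply, ← Matrix.smul_one_eq_diagonal,
          Matrix.smul_mulVec, Matrix.one_mulVec, add_sub_cancel, Matrix.mulVec_mulVec,
          Matrix.mulVec_mulVec, hcomm.eq]
      rw [h1]
      exact (hX t).matrix_mulVec G
    · simpa only [Matrix.mulVec_mulVec, List.map_cons, List.prod_cons] using h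

/-- Solutions of `X' = F X` vanish at infinity if `F` is a Hurwitz matrix. -/
theorem tendsto_zero_of_hurwitz {ι : Type*} [Fintype ι] [DecidableEq ι]
    {F : Matrix ι ι ℂ} (hF : ∀ (μ : ℂ) (w : ι → ℂ), w ≠ 0 → F *ᵥ w = μ • w → μ.re < 0)
    {X : ℝ → ι → ℂ} (hX : ∀ t, HasDerivAt X (F *ᵥ X t) t) : Tendsto X atTop (𝓝 0) := by
  refine tendsto_zero_of_prod_sub_mulVec F.charpoly.roots.toList (fun μ hμ => ?_) hX ?_
  · rw [Multiset.mem_toList, Polynomial.mem_roots F.charpoly_monic.ne_zero,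
      Polynomial.IsRoot.def, Matrix.eval_charpoly] at hμ
    obtain ⟨w, hw, h⟩ := Matrix.exists_mulVec_eq_zero_iff.2 hμ
    refine hF μ w hw ?_
    rw [Matrix.sub_mulVec, Matrix.scalar_apply, ← Matrix.smul_one_eq_diagonal,
        Matrix.smul_mulVec, Matrix.one_mulVec] at h
    exact (sub_eq_zero.1 h).symm
  -- By Cayley–Hamilton, the product over all roots of the characteristic polynomial is zero, so the
  -- limit required to start the peeling is trivial.
  · have h1 := F.aeval_self_charpoly
    rw [(IsAlgClosed.splits F.charpoly).eq_prod_roots_of_monic F.charpoly_monic,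
      ← Multiset.coe_toList F.charpoly.roots, Multiset.map_coe, Multiset.prod_coe,
      map_list_prod, List.map_map] at h1
    have h2 : (⇑(Polynomial.aeval F) ∘ fun a : ℂ => Polynomial.X - Polynomial.C a) =
        fun μ : ℂ => F - Matrix.scalar ι μ := by
      ext1 μ
      simp [Matrix.algebraMap_eq_diagonal, Matrix.scalar_apply]
    rw [h2] at h1
    simp only [h1, Matrix.zero_mulVec, tendsto_const_nhds]

/-- Quadratic eigenvalues of a dissipative oscillator without undamped modes are stable. -/
theorem re_neg_of_quadratic_eigenvector {ι : Type*} [Fintype ι] {A B : Matrix ι ι ℂ}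
    (hA : A.PosDef) (hB : B.PosSemidef)
    (hAB : ∀ (w : ι → ℂ) (c : ℂ), B *ᵥ w = 0 → A *ᵥ w = c • w → w = 0)
    {s : ℂ} {w : ι → ℂ} (hw : w ≠ 0) (h : s ^ 2 • w + s • B *ᵥ w + A *ᵥ w = 0) : s.re < 0 := by
  -- Pairing with `w` gives a scalar equation `c s² + b s + a = 0` with `a, c > 0` and `b ≥ 0`. If
  -- `Re s ≥ 0`, its real and imaginary parts leave only `b = 0`, hence `B w = 0` and `w` is an
  -- undamped mode.
  have h1 := congrArg (star w ⬝ᵥ ·) h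
  simp only [dotProduct_add, dotProduct_smul, dotProduct_zero, smul_eq_mul] at h1
  have ha := hA.dotProduct_mulVec_pos hw
  have hb := hB.dotProduct_mulVec_nonneg w
  have hc : 0 < star w ⬝ᵥ w := Matrix.dotProduct_star_self_pos_iff.2 hw
  have hb0 := hB.dotProduct_mulVec_zero_iff w
  revert h1 ha hb hc hb0
  generalize star w ⬝ᵥ A *ᵥ w = a
  generalize star w ⬝ᵥ B *ᵥ w = b
  generalize star w ⬝ᵥ w = c
  intro h1 ha hb hc hb0
  rw [Complex.lt_def] at ha hc
  rw [Complex.le_def] at hb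
  simp only [Complex.zero_re, Complex.zero_im] at ha hb hc
  obtain ⟨har, hai⟩ := ha
  obtain ⟨hbr, hbi⟩ := hb
  obtain ⟨hcr, hci⟩ := hc
  by_contra! hs
  have hre := congrArg Complex.re h1
  have him := congrArg Complex.im h1
  simp [pow_two, ← hai, ← hbi, ← hci] at hre him
  have hb_zero : b.re = 0 := by
    by_contra hne
    have hbpos : 0 < b.re := lt_of_le_of_ne hbr (Ne.symm hne)
    have him' : s.im * (2 * s.re * c.re + b.re) = 0 := by linarith
    rcases mul_eq_zero.1 him' with h0 | h0
    · rw [h0] at hre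
      have : 0 ≤ s.re * s.re * c.re := by positivity
      have : 0 ≤ s.re * b.re := by positivity
      nlinarith
    · have : 0 ≤ s.re * c.re := by positivity
      linarith
  have hBw : B *ᵥ w = 0 := hb0.1 (Complex.ext hb_zero hbi.symm)
  refine hw (hAB w (-s ^ 2) hBw ?_)
  rw [hBw, smul_zero, add_zero] at h
  rw [neg_smul]
  exact eq_neg_of_add_eq_zero_right h

/-- A dissipative oscillator without undamped modes is asymptotically stable. -/
theorem tendsto_zero_of_damped {ι : Type*} [Fintype ι] [DecidableEq ι] {A B : Matrix ι ι ℂ}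
    (hA : A.PosDef) (hB : B.PosSemidef)
    (hAB : ∀ (w : ι → ℂ) (c : ℂ), B *ᵥ w = 0 → A *ᵥ w = c • w → w = 0)
    {x v a : ℝ → ι → ℂ} (hx : ∀ t, HasDerivAt x (v t) t) (hv : ∀ t, HasDerivAt v (a t) t)
    (h : ∀ t, a t + B *ᵥ v t + A *ᵥ x t = 0) : Tendsto x atTop (𝓝 0) := by
  have key : Tendsto (fun t => Sum.elim (x t) (v t)) atTop (𝓝 0) := by
    refine tendsto_zero_of_hurwitz (F := Matrix.fromBlocks 0 1 (-A) (-B)) ?_ ?_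
    · intro μ w hw0 hw
      obtain ⟨p, r, rfl⟩ : ∃ p r, w = Sum.elim p r :=
        ⟨w ∘ Sum.inl, w ∘ Sum.inr, (Sum.elim_comp_inl_inr w).symm⟩
      rw [Matrix.fromBlocks_mulVec] at hw
      have h1 : r = μ • p := by
        have := congrArg (· ∘ Sum.inl) hw
        simpa [funext_iff] using this
      have h2 : -(A *ᵥ p) - B *ᵥ r = μ • r := by
        have := congrArg (· ∘ Sum.inr) hw
        simpa [funext_iff, Matrix.neg_mulVec, sub_eq_add_neg] using this
      subst h1
      refine re_neg_of_quadratic_eigenvector hA hB hAB (s := μ) (w := p) ?_ ?_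
      · rintro rfl
        exact hw0 (by ext (i | i) <;> simp)
      · rw [Matrix.mulVec_smul, smul_smul, ← pow_two] at h2
        rw [← h2]; abel
    · intro t
      rw [hasDerivAt_pi]
      rw [Matrix.fromBlocks_mulVec]
      have h3 : a t = -(A *ᵥ x t) - B *ᵥ v t := by
        have := h t
        rw [← sub_eq_zero, ← this]; abel
      rintro (i | i)
      · simpa using hasDerivAt_pi.1 (hx t) i
      · have := hasDerivAt_pi.1 (hv t) i
        rw [h3] at this
        simpa [Matrix.neg_mulVec, sub_eq_add_neg] using this
  rw [tendsto_pi_nhds] at key ⊢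
  intro i
  simpa using key (Sum.inl i)

/-! ### Counting eigenvalues by real part -/

/-- In a sorted list the nonpositive entries form an initial segment. The bound `hm` keeps the
default value of `getD` out of play. -/
theorem zero_lt_getD_iff_countP_le {l : List ℝ} (hl : l.Pairwise (· ≤ ·)) {m : ℕ}
    (hm : m < l.length) : 0 < l.getD m 0 ↔ l.countP (· ≤ 0) ≤ m := by
  rw [List.getD_eq_getElem _ _ hm]
  constructor
  · intro h
    rw [← List.take_append_drop m l, List.countP_append]
    have h1 : (l.drop m).countP (· ≤ 0) = 0 := by
      rw [List.countP_eq_zero]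
      intro a ha
      obtain ⟨i, hi, rfl⟩ := List.getElem_of_mem ha
      rw [List.getElem_drop]
      have : l[m] ≤ l[m + i]'(by rw [List.length_drop] at hi; omega) := by
        rcases Nat.eq_zero_or_pos i with rfl | hi0
        · rfl
        · exact List.pairwise_iff_getElem.1 hl _ _ _ _ (by omega)
      simpa using h.trans_le this
    have h2 := (List.countP_le_length (p := fun x : ℝ => decide (x ≤ 0)) (l := l.take m))
    rw [List.length_take] at h2
    omega
  · intro h
    by_contra! h0
    have h1 : (l.take (m + 1)).countP (· ≤ 0) = m + 1 := by
      have : (l.take (m + 1)).length = m + 1 := by rw [List.length_take]; omega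
      refine (List.countP_eq_length.2 ?_).trans this
      intro a ha
      obtain ⟨i, hi, rfl⟩ := List.getElem_of_mem ha
      rw [List.getElem_take]
      have hi' : i ≤ m := by omega
      have : l[i]'(by omega) ≤ l[m] := by
        rcases hi'.eq_or_lt with rfl | hi0
        · rfl
        · exact List.pairwise_iff_getElem.1 hl _ _ _ _ hi0
      simpa using this.trans h0
    have h2 := (List.take_sublist (m + 1) l).countP_le (p := fun x : ℝ => decide (x ≤ 0))
    omega

theorem zero_lt_reLambda_succ_iff {ι : Type*} [Fintype ι] [DecidableEq ι] (X : Matrix ι ι ℂ)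
    {m : ℕ} (hm : m < Fintype.card ι) :
    0 < reLambda (m + 1) X ↔ X.charpoly.roots.countP (fun μ => μ.re ≤ 0) ≤ m := by
  unfold reLambda
  have hcard : (X.charpoly.roots.map Complex.re).card = Fintype.card ι := by
    rw [Multiset.card_map, ← (IsAlgClosed.splits X.charpoly).natDegree_eq_card_roots,
      X.charpoly_natDegree_eq_dim]
  rw [Nat.add_sub_cancel, zero_lt_getD_iff_countP_le
      (Multiset.pairwise_sort (X.charpoly.roots.map Complex.re) (· ≤ ·)) (by rwa [Multiset.length_sort, hcard]),
    ← Multiset.coe_countP, Multiset.sort_eq, Multiset.countP_map, Multiset.countP_eq_card_filter]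

theorem iSupIndep.finrank_biSup_finset {𝕜 V κ : Type*} [Field 𝕜] [AddCommGroup V] [Module 𝕜 V]
    [FiniteDimensional 𝕜 V] {E : κ → Submodule 𝕜 V} (hE : iSupIndep E) (s : Finset κ) :
    Module.finrank 𝕜 (⨆ i ∈ s, E i : Submodule 𝕜 V) = ∑ i ∈ s, Module.finrank 𝕜 (E i) := by
  classical
  induction s using Finset.induction_on with
  | empty => simp
  | insert i s hi ih =>
    have h1 := hE.disjoint_biSup (x := i) (y := (s : Set κ)) (by simpa using hi)
    have h2 := Submodule.finrank_sup_add_finrank_inf_eq (E i) (⨆ j ∈ s, E j)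
    have h3 : E i ⊓ (⨆ j ∈ s, E j) = ⊥ := by simpa using h1.eq_bot
    rw [h3, finrank_bot, add_zero] at h2
    rw [Finset.iSup_insert, h2, ih, Finset.sum_insert hi]

/-- Algebraic multiplicities are dimensions of generalized eigenspaces, and these spaces are
independent, so counting roots becomes computing one dimension. -/
theorem countP_roots_charpoly {ι : Type*} [Fintype ι] [DecidableEq ι] (X : Matrix ι ι ℂ)
    (p : ℂ → Prop) [DecidablePred p] :
    X.charpoly.roots.countP p = Module.finrank ℂ
      (⨆ μ ∈ X.charpoly.roots.toFinset.filter p, Module.End.maxGenEigenspace X.mulVecLin μ :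
        Submodule ℂ (ι → ℂ)) := by
  rw [(Module.End.independent_maxGenEigenspace X.mulVecLin).finrank_biSup_finset,
    Multiset.countP_eq_card_filter, ← Multiset.toFinset_sum_count_eq, Multiset.toFinset_filter]
  refine Finset.sum_congr rfl fun μ hμ => ?_
  rw [LinearMap.finrank_maxGenEigenspace_eq, Matrix.charpoly_mulVecLin,
    Multiset.count_filter_of_pos (Finset.mem_filter.1 hμ).2, Polynomial.count_roots]

/-! ### The spectrum of `B + iA` near the imaginary axis -/

section Dissipative

variable {ι : Type*} [Fintype ι] {A B : Matrix ι ι ℂ}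

/-- Pairing with `w`, the term from `iA` is purely imaginary and drops out of the real part. -/
theorem add_I_smul_eigenvector_re (hA : A.PosSemidef) {μ : ℂ} {w : ι → ℂ}
    (h : (B + Complex.I • A) *ᵥ w = μ • w) :
    μ.re * (star w ⬝ᵥ w).re = (star w ⬝ᵥ B *ᵥ w).re := by
  have h1 := congrArg (fun z => (star w ⬝ᵥ z).re) h
  have ha := hA.dotProduct_mulVec_nonneg w
  have hc : 0 ≤ star w ⬝ᵥ w := dotProduct_star_self_nonneg w
  rw [Complex.le_def] at ha hc
  simpa [Matrix.add_mulVec, Matrix.smul_mulVec, ← ha.2, ← hc.2] using h1.symm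

theorem re_nonneg_of_add_I_smul_eigenvector (hA : A.PosSemidef) (hB : B.PosSemidef) {μ : ℂ}
    {w : ι → ℂ} (hw : w ≠ 0) (h : (B + Complex.I • A) *ᵥ w = μ • w) : 0 ≤ μ.re := by
  have h1 := add_I_smul_eigenvector_re hA h
  have hc : 0 < star w ⬝ᵥ w := Matrix.dotProduct_star_self_pos_iff.2 hw
  have hb := hB.dotProduct_mulVec_nonneg w
  rw [Complex.lt_def] at hc
  rw [Complex.le_def] at hb
  have h2 : 0 ≤ μ.re * (star w ⬝ᵥ w).re := h1 ▸ hb.1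
  exact nonneg_of_mul_nonneg_left h2 hc.1

theorem eigenvector_of_add_I_smul_eigenvector (hA : A.PosSemidef) (hB : B.PosSemidef) {μ : ℂ}
    (hμ : μ.re = 0) {w : ι → ℂ} (h : (B + Complex.I • A) *ᵥ w = μ • w) :
    B *ᵥ w = 0 ∧ A *ᵥ w = (-Complex.I * μ) • w := by
  have h1 := add_I_smul_eigenvector_re hA h
  rw [hμ, zero_mul] at h1
  have hb := hB.dotProduct_mulVec_nonneg w
  rw [Complex.le_def] at hb
  have hBw : B *ᵥ w = 0 :=
    (hB.dotProduct_mulVec_zero_iff w).1 (Complex.ext h1.symm hb.2.symm)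
  refine ⟨hBw, ?_⟩
  rw [Matrix.add_mulVec, hBw, zero_add, Matrix.smul_mulVec] at h
  rw [mul_smul, ← h, smul_smul]
  simp

/-- Eigenvalues of `B + jA` on the imaginary axis are semisimple. -/
theorem add_I_smul_semisimple (hA : A.PosSemidef) (hB : B.PosSemidef) {μ : ℂ}
    (hμ : μ.re = 0) {w u : ι → ℂ} (hu : u = (B + Complex.I • A) *ᵥ w - μ • w)
    (h : (B + Complex.I • A) *ᵥ u = μ • u) : u = 0 := by
  obtain ⟨h1, h2⟩ := eigenvector_of_add_I_smul_eigenvector hA hB hμ h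
  -- As `A` and `B` are Hermitian, `u` is also a left eigenvector of `B + iA` for `μ`; here `Re μ =
  -- 0` is used. So `u` is orthogonal to the range of `B + iA - μ`, in which it lies itself.
  have h3 (z : ι → ℂ) : star u ⬝ᵥ B *ᵥ z = 0 := by
    have := congrArg star h1
    rw [Matrix.star_mulVec, hB.1.eq] at this
    rw [Matrix.dotProduct_mulVec, this, star_zero, zero_dotProduct]
  have h4 (z : ι → ℂ) : star u ⬝ᵥ A *ᵥ z = star (-Complex.I * μ) * (star u ⬝ᵥ z) := by
    have := congrArg star h2
    rw [Matrix.star_mulVec, hA.1.eq] at this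
    rw [Matrix.dotProduct_mulVec, this, star_smul, smul_dotProduct, smul_eq_mul]
  have h5 : Complex.I * star (-Complex.I * μ) = μ := by
    apply Complex.ext <;> simp [hμ]
  refine dotProduct_star_self_eq_zero.1 ((congrArg (star u ⬝ᵥ ·) hu).trans ?_)
  rw [dotProduct_sub, Matrix.add_mulVec, dotProduct_add, h3, Matrix.smul_mulVec,
    dotProduct_smul, h4, dotProduct_smul, smul_eq_mul, smul_eq_mul, ← mul_assoc, h5]
  ring

theorem eigenvector_of_mem_maxGenEigenspace (hA : A.PosSemidef) (hB : B.PosSemidef) {μ : ℂ}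
    (hμ : μ.re = 0) {w : ι → ℂ}
    (hw : w ∈ Module.End.maxGenEigenspace (B + Complex.I • A).mulVecLin μ) :
    (B + Complex.I • A) *ᵥ w = μ • w := by
  rw [Module.End.mem_maxGenEigenspace] at hw
  set N : Module.End ℂ (ι → ℂ) := (B + Complex.I • A).mulVecLin - μ • 1 with hN
  have happ (z : ι → ℂ) : N z = (B + Complex.I • A) *ᵥ z - μ • z := by
    simp [hN, Matrix.add_mulVec, Matrix.smul_mulVec]
  obtain ⟨k, hk⟩ := hw
  -- Raising the exponent by one lets the induction start at `N w = 0`; each further step removes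
  -- one power by semisimplicity.
  suffices ∀ k : ℕ, (N ^ (k + 1)) w = 0 → N w = 0 by
    rw [← sub_eq_zero, ← happ]
    exact this k (by rw [pow_succ', Module.End.mul_apply, hk, map_zero])
  intro k
  induction k with
  | zero => simp
  | succ k ih =>
    intro h
    refine ih ?_
    rw [pow_succ', Module.End.mul_apply, pow_succ', Module.End.mul_apply, happ,
      sub_eq_zero] at h
    rw [pow_succ', Module.End.mul_apply]
    exact add_I_smul_semisimple hA hB hμ (happ _) h

/-- The span of the common eigenvectors of `A` and `B` in the kernel of `B`. -/
noncomputable def undampedSpace (A B : Matrix ι ι ℂ) : Submodule ℂ (ι → ℂ) :=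
  ⨆ c : ℂ, LinearMap.ker B.mulVecLin ⊓ Module.End.eigenspace A.mulVecLin c

theorem undampedSpace_le_iff {S : Submodule ℂ (ι → ℂ)} :
    undampedSpace A B ≤ S ↔ ∀ (w : ι → ℂ) (c : ℂ), B *ᵥ w = 0 → A *ᵥ w = c • w → w ∈ S := by
  rw [undampedSpace, iSup_le_iff]
  simp only [SetLike.le_def, Submodule.mem_inf, LinearMap.mem_ker,
    Module.End.mem_eigenspace_iff, Matrix.mulVecLin_apply, and_imp]
  exact forall_comm

theorem mem_undampedSpace {w : ι → ℂ} {c : ℂ} (hB : B *ᵥ w = 0) (hA : A *ᵥ w = c • w) :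
    w ∈ undampedSpace A B :=
  undampedSpace_le_iff.1 le_rfl w c hB hA

theorem im_eq_zero_of_eigenvector (hA : A.PosSemidef) {w : ι → ℂ} (hw : w ≠ 0) {c : ℂ}
    (h : A *ᵥ w = c • w) : c.im = 0 := by
  have h1 := congrArg (fun z => (star w ⬝ᵥ z).im) h
  have ha := hA.dotProduct_mulVec_nonneg w
  have hc : 0 < star w ⬝ᵥ w := Matrix.dotProduct_star_self_pos_iff.2 hw
  rw [Complex.lt_def] at hc
  rw [Complex.le_def] at ha
  have hc0 : (star w ⬝ᵥ w).re ≠ 0 := hc.1.ne'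
  simpa [← ha.2, ← hc.2, hc0] using h1

theorem finrank_undampedSpace [DecidableEq ι] (hA : A.PosSemidef) (hB : B.PosSemidef) :
    Module.finrank ℂ (undampedSpace A B) =
      (B + Complex.I • A).charpoly.roots.countP (fun μ => μ.re ≤ 0) := by
  have hroot {μ : ℂ} : μ ∈ (B + Complex.I • A).charpoly.roots ↔
      ∃ w, w ≠ 0 ∧ (B + Complex.I • A) *ᵥ w = μ • w := by
    rw [Polynomial.mem_roots (Matrix.charpoly_monic _).ne_zero, Polynomial.IsRoot.def,
      Matrix.eval_charpoly, ← Matrix.exists_mulVec_eq_zero_iff]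
    refine exists_congr fun w => and_congr_right fun _ => ?_
    rw [Matrix.sub_mulVec, Matrix.scalar_apply, ← Matrix.smul_one_eq_diagonal,
      Matrix.smul_mulVec, Matrix.one_mulVec, sub_eq_zero, eq_comm]
  rw [countP_roots_charpoly]
  refine congrArg (fun S : Submodule ℂ (ι → ℂ) => Module.finrank ℂ S) ?_
  refine le_antisymm (undampedSpace_le_iff.2 fun w c hBw hAw => ?_)
    (iSup₂_le fun μ hμ w hw => ?_)
  · rcases eq_or_ne w 0 with rfl | hw
    · exact zero_mem _
    have h : (B + Complex.I • A) *ᵥ w = (Complex.I * c) • w := by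
      rw [Matrix.add_mulVec, hBw, zero_add, Matrix.smul_mulVec, hAw, smul_smul]
    refine Submodule.mem_iSup_of_mem (Complex.I * c) (Submodule.mem_iSup_of_mem ?_ ?_)
    · simp only [Finset.mem_filter, Multiset.mem_toFinset]
      exact ⟨hroot.2 ⟨w, hw, h⟩, by simp [im_eq_zero_of_eigenvector hA hw hAw]⟩
    · exact Module.End.eigenspace_le_maxGenEigenspace (Module.End.mem_eigenspace_iff.2 h)
  · simp only [Finset.mem_filter, Multiset.mem_toFinset] at hμ
    obtain ⟨z, hz0, hz⟩ := hroot.1 hμ.1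
    have hre := le_antisymm hμ.2 (re_nonneg_of_add_I_smul_eigenvector hA hB hz0 hz)
    obtain ⟨h1, h2⟩ := eigenvector_of_add_I_smul_eigenvector hA hB hre
      (eigenvector_of_mem_maxGenEigenspace hA hB hre hw)
    exact mem_undampedSpace h1 h2

/-- The eigenvalue condition bounds the dimension of the undamped space by that of its subspace `S`,
which forces equality. -/
theorem zero_lt_reLambda_iff_forall_mem [DecidableEq ι] (hA : A.PosSemidef) (hB : B.PosSemidef)
    {S : Submodule ℂ (ι → ℂ)} (hS : S ≤ undampedSpace A B)
    (hcard : Module.finrank ℂ S < Fintype.card ι) :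
    0 < reLambda (Module.finrank ℂ S + 1) (B + Complex.I • A) ↔
      ∀ (w : ι → ℂ) (c : ℂ), B *ᵥ w = 0 → A *ᵥ w = c • w → w ∈ S := by
  rw [zero_lt_reLambda_succ_iff _ hcard, ← finrank_undampedSpace hA hB, ← undampedSpace_le_iff]
  exact ⟨fun h => (Submodule.eq_of_le_of_finrank_le hS h).ge, Submodule.finrank_mono⟩

end Dissipative

/-! ### Real damped motions and their complexification -/

section RealMatrices

variable {ι : Type*} [Fintype ι]

open scoped MatrixOrder in
theorem Matrix.PosSemidef.map_ofReal [DecidableEq ι] {A : Matrix ι ι ℝ} (hA : A.PosSemidef) :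
    (A.map Complex.ofReal).PosSemidef := by
  have h1 : CFC.sqrt A * CFC.sqrt A = A := CFC.sqrt_mul_sqrt_self A hA.nonneg
  have h2 : (CFC.sqrt A).IsHermitian := (Matrix.nonneg_iff_posSemidef.1 (CFC.sqrt_nonneg A)).1
  have h3 : ((CFC.sqrt A).map Complex.ofReal)ᴴ = (CFC.sqrt A).map Complex.ofReal := by
    ext i j
    simp [← h2.apply i j]
  have h4 : A.map Complex.ofReal =
      ((CFC.sqrt A).map Complex.ofReal)ᴴ * (CFC.sqrt A).map Complex.ofReal := by
    rw [h3]
    conv_lhs => rw [← h1]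
    exact Matrix.map_mul (f := Complex.ofRealHom)
  rw [h4]
  exact Matrix.posSemidef_conjTranspose_mul_self _

theorem Matrix.PosDef.map_ofReal [DecidableEq ι] {A : Matrix ι ι ℝ} (hA : A.PosDef) :
    (A.map Complex.ofReal).PosDef := by
  rw [hA.posSemidef.map_ofReal.posDef_iff_det_ne_zero]
  have h := Complex.ofRealHom.map_det A
  simp only [Complex.ofRealHom_eq_coe, RingHom.mapMatrix_apply] at h
  rw [show A.map Complex.ofReal = A.map Complex.ofRealHom from rfl, ← h]
  simpa using hA.det_pos.ne'

theorem Matrix.map_ofReal_mulVec (A : Matrix ι ι ℝ) (w : ι → ℝ) :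
    A.map Complex.ofReal *ᵥ (fun i => (w i : ℂ)) = fun i => ((A *ᵥ w) i : ℂ) := by
  ext i
  simp [Matrix.mulVec, dotProduct]

theorem Matrix.map_ofReal_mulVec_re (A : Matrix ι ι ℝ) (w : ι → ℂ) (i : ι) :
    ((A.map Complex.ofReal *ᵥ w) i).re = (A *ᵥ fun i => (w i).re) i := by
  simp [Matrix.mulVec, dotProduct]

theorem Matrix.map_ofReal_mulVec_im (A : Matrix ι ι ℝ) (w : ι → ℂ) (i : ι) :
    ((A.map Complex.ofReal *ᵥ w) i).im = (A *ᵥ fun i => (w i).im) i := by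
  simp [Matrix.mulVec, dotProduct]

/-- The eigenvalue `c` is real, so real and imaginary parts of the eigenvector separate. For `w =
0`, where `c` is arbitrary, `d = 0` serves. -/
theorem exists_re_im_eigenvector [DecidableEq ι] {A B : Matrix ι ι ℝ} (hA : A.PosSemidef)
    {w : ι → ℂ} {c : ℂ} (hBw : B.map Complex.ofReal *ᵥ w = 0)
    (hAw : A.map Complex.ofReal *ᵥ w = c • w) : ∃ d : ℝ,
      (B *ᵥ (fun i => (w i).re) = 0 ∧ A *ᵥ (fun i => (w i).re) = d • fun i => (w i).re) ∧
      (B *ᵥ (fun i => (w i).im) = 0 ∧ A *ᵥ (fun i => (w i).im) = d • fun i => (w i).im) := by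
  rcases eq_or_ne w 0 with rfl | hw
  · refine ⟨0, ?_⟩
    simp [← Pi.zero_def]
  have hc := im_eq_zero_of_eigenvector hA.map_ofReal hw hAw
  refine ⟨c.re, ⟨?_, ?_⟩, ?_, ?_⟩ <;> ext i
  · simp [← Matrix.map_ofReal_mulVec_re, hBw]
  · simp [← Matrix.map_ofReal_mulVec_re, hAw, hc]
  · simp [← Matrix.map_ofReal_mulVec_im, hBw]
  · simp [← Matrix.map_ofReal_mulVec_im, hAw, hc]

/-- `z'' + B z' + A z = 0`, where `v = z'` and `a = z''`. -/
structure IsDampedMotion (A B : Matrix ι ι ℝ) (z v a : ℝ → ι → ℝ) : Prop where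
  hasDerivAt : ∀ t, HasDerivAt z (v t) t
  hasDerivAt' : ∀ t, HasDerivAt v (a t) t
  eq : ∀ t, a t + B *ᵥ v t + A *ᵥ z t = 0

theorem IsDampedMotion.tendsto_zero [DecidableEq ι] {A B : Matrix ι ι ℝ} (hA : A.PosDef)
    (hB : B.PosSemidef) (hAB : ∀ (w : ι → ℝ) (c : ℝ), B *ᵥ w = 0 → A *ᵥ w = c • w → w = 0)
    {z v a : ℝ → ι → ℝ} (h : IsDampedMotion A B z v a) : Tendsto z atTop (𝓝 0) := by
  have hcast {f f' : ℝ → ι → ℝ} (hf : ∀ t, HasDerivAt f (f' t) t) (t : ℝ) :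
      HasDerivAt (fun t i => (f t i : ℂ)) (fun i => (f' t i : ℂ)) t :=
    hasDerivAt_pi.2 fun i => (hasDerivAt_pi.1 (hf t) i).ofReal_comp
  have key : Tendsto (fun t i => (z t i : ℂ)) atTop (𝓝 0) := by
    refine tendsto_zero_of_damped hA.map_ofReal hB.map_ofReal (fun w c h1 h2 => ?_)
      (hcast h.hasDerivAt) (hcast h.hasDerivAt') fun t => ?_
    · obtain ⟨d, h3, h4⟩ := exists_re_im_eigenvector hA.posSemidef h1 h2
      have h5 := hAB _ _ h3.1 h3.2
      have h6 := hAB _ _ h4.1 h4.2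
      ext i
      exact Complex.ext (congrFun h5 i) (congrFun h6 i)
    · rw [Matrix.map_ofReal_mulVec, Matrix.map_ofReal_mulVec]
      ext i
      simpa [← Complex.ofReal_add] using congrFun (h.eq t) i
  rw [tendsto_pi_nhds] at key ⊢
  intro i
  exact (Complex.continuous_re.tendsto _).comp (key i)

/-- A damped motion approaches the range of a projection that commutes with the dynamics,
provided that the range contains all undamped modes. -/
theorem IsDampedMotion.tendsto_sub_proj [DecidableEq ι] {A B J : Matrix ι ι ℝ} (hA : A.PosDef)
    (hB : B.PosSemidef) (hJ : J.PosSemidef) (hJJ : J * J = J) (hAJ : A * J = J * A)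
    (hBJ : B * J = 0) (hJB : J * B = 0)
    (hAB : ∀ (w : ι → ℝ) (c : ℝ), B *ᵥ w = 0 → A *ᵥ w = c • w → J *ᵥ w = w)
    {z v a : ℝ → ι → ℝ} (h : IsDampedMotion A B z v a) :
    Tendsto (fun t => (1 - J) *ᵥ z t) atTop (𝓝 0) := by
  -- The extra damping `J` does not act on `(1 - J) z`, but it removes the modes in the range of
  -- `J`: `(B + J) w = 0` gives `J w = 0` and `B w = 0`, whence `w = J w = 0`.
  refine IsDampedMotion.tendsto_zero (B := B + J) (v := fun t => (1 - J) *ᵥ v t)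
    (a := fun t => (1 - J) *ᵥ a t) hA (hB.add hJ) (fun w c h1 h2 => ?_)
    ⟨fun t => (h.hasDerivAt t).matrix_mulVec _, fun t => (h.hasDerivAt' t).matrix_mulVec _,
      fun t => ?_⟩
  · have h3 := congrArg (J *ᵥ ·) h1
    simp only [Matrix.mulVec_mulVec, mul_add, hJB, hJJ, zero_add, Matrix.mulVec_zero] at h3
    have h4 : B *ᵥ w = 0 := by simpa [Matrix.add_mulVec, h3] using h1
    rw [← hAB w c h4 h2, h3]
  · have h1 : (B + J) * (1 - J) = (1 - J) * B := by
      simp [mul_sub, sub_mul, add_mul, hBJ, hJB, hJJ]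
    have h2 : A * (1 - J) = (1 - J) * A := by simp [mul_sub, sub_mul, hAJ]
    rw [Matrix.mulVec_mulVec, Matrix.mulVec_mulVec, h1, h2, ← Matrix.mulVec_mulVec,
      ← Matrix.mulVec_mulVec, ← Matrix.mulVec_add, ← Matrix.mulVec_add, h.eq,
      Matrix.mulVec_zero]

theorem isDampedMotion_cos {A B : Matrix ι ι ℝ} {w : ι → ℝ} {c : ℝ} (hc : 0 ≤ c)
    (hBw : B *ᵥ w = 0) (hAw : A *ᵥ w = c • w) :
    IsDampedMotion A B (fun t => Real.cos (√c * t) • w) (fun t => (-Real.sin (√c * t) * √c) • w)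
      (fun t => (-(Real.cos (√c * t) * √c) * √c) • w) where
  hasDerivAt t := by
    have h : HasDerivAt (fun t => √c * t) √c t := by simpa using (hasDerivAt_id t).const_mul √c
    exact h.cos.smul_const w
  hasDerivAt' t := by
    have h : HasDerivAt (fun t => √c * t) √c t := by simpa using (hasDerivAt_id t).const_mul √c
    exact (h.sin.neg.mul_const √c).smul_const w
  eq t := by
    rw [Matrix.mulVec_smul, Matrix.mulVec_smul, hBw, hAw, smul_zero, add_zero, smul_smul,
      ← add_smul]
    have : √c * √c = c := Real.mul_self_sqrt hc
    rw [show -(Real.cos (√c * t) * √c) * √c + Real.cos (√c * t) * c = 0 by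
      linear_combination (-Real.cos (√c * t)) * this, zero_smul]

end RealMatrices

/-! ### Matrix-weighted Laplacians and the synchronous projection -/

section Lap

variable {q n : ℕ}

theorem lap_mulVec {W : Fin q → Fin q → Matrix (Fin n) (Fin n) ℝ} (hW : ∀ i, W i i = 0)
    (z : Fin q × Fin n → ℝ) (i : Fin q) (a : Fin n) :
    (lap W *ᵥ z) (i, a) = ∑ j, (W i j *ᵥ fun b => z (i, b) - z (j, b)) a := by
  have h1 (j : Fin q) (b : Fin n) : lap W (i, a) (j, b) =
      (if i = j then ∑ l, W i l a b else 0) - W i j a b := by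
    by_cases hij : i = j
    · subst hij
      simp [lap, Matrix.sum_apply, hW]
    · simp [lap, hij]
  simp only [Matrix.mulVec, dotProduct, Fintype.sum_prod_type, h1, sub_mul, mul_sub,
    Finset.sum_sub_distrib, ite_mul, zero_mul]
  congr 1
  rw [Finset.sum_comm]
  simp only [Finset.sum_ite_eq, Finset.mem_univ, if_true, Finset.sum_mul]
  exact Finset.sum_comm

theorem CoupledOsc.IsCoupling.conj {W : Fin q → Fin q → Matrix (Fin n) (Fin n) ℝ} (hW : IsCoupling W)
    {C : Matrix (Fin n) (Fin n) ℝ} (hC : C.IsHermitian) :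
    IsCoupling fun i j => C * W i j * C where
  posSemidef i j := by
    simpa only [hC.eq] using (hW.posSemidef i j).conjTranspose_mul_mul_same C
  symm i j := by rw [hW.symm]
  diag i := by simp [hW.diag]

theorem lap_isHermitian {W : Fin q → Fin q → Matrix (Fin n) (Fin n) ℝ} (hW : IsCoupling W) :
    (lap W).IsHermitian := by
  have h (i j : Fin q) (a b : Fin n) : W i j a b = W i j b a := by
    simpa using ((hW.posSemidef i j).1.apply b a)
  refine Matrix.IsHermitian.ext ?_
  rintro ⟨i, a⟩ ⟨j, b⟩
  by_cases hij : i = j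
  · subst hij
    simp only [lap, Matrix.of_apply, if_true, star_trivial, Matrix.sum_apply]
    exact Finset.sum_congr rfl fun l _ => h _ _ _ _
  · simp [lap, hij, Ne.symm hij, hW.symm j i, h i j b a]

theorem lap_posSemidef {W : Fin q → Fin q → Matrix (Fin n) (Fin n) ℝ} (hW : IsCoupling W) :
    (lap W).PosSemidef := by
  refine .of_dotProduct_mulVec_nonneg (lap_isHermitian hW) fun z => ?_
  set y : Fin q → Fin q → Fin n → ℝ := fun i j b => z (i, b) - z (j, b) with hy
  have h1 : star z ⬝ᵥ lap W *ᵥ z = ∑ i, ∑ j, (fun b => z (i, b)) ⬝ᵥ W i j *ᵥ y i j := by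
    simp only [dotProduct, Fintype.sum_prod_type, lap_mulVec hW.diag, star_trivial,
      Finset.mul_sum]
    exact Finset.sum_congr rfl fun i _ => Finset.sum_comm
  have h2 : star z ⬝ᵥ lap W *ᵥ z = ∑ i, ∑ j, -((fun b => z (j, b)) ⬝ᵥ W i j *ᵥ y i j) := by
    rw [h1, Finset.sum_comm]
    refine Finset.sum_congr rfl fun i _ => Finset.sum_congr rfl fun j _ => ?_
    have : y j i = -y i j := by ext b; simp [hy]
    rw [hW.symm j i, this, Matrix.mulVec_neg, dotProduct_neg]
  -- Averaging the quadratic form with its copy under `i ↔ j` turns it into a sum of the nonnegative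
  -- edge energies of the differences `y i j`.
  have h3 : 2 * (star z ⬝ᵥ lap W *ᵥ z) = ∑ i, ∑ j, y i j ⬝ᵥ W i j *ᵥ y i j := by
    rw [two_mul]
    nth_rw 1 [h1]
    rw [h2, ← Finset.sum_add_distrib]
    refine Finset.sum_congr rfl fun i _ => ?_
    rw [← Finset.sum_add_distrib]
    refine Finset.sum_congr rfl fun j _ => ?_
    rw [← sub_eq_add_neg, ← sub_dotProduct]
    rfl
  have h4 : 0 ≤ ∑ i, ∑ j, y i j ⬝ᵥ W i j *ᵥ y i j :=
    Finset.sum_nonneg fun i _ => Finset.sum_nonneg fun j _ => by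
      simpa using (hW.posSemidef i j).dotProduct_mulVec_nonneg (y i j)
  linarith

/-- The orthogonal projection onto the synchronous states. -/
noncomputable def syncProj (q n : ℕ) : Matrix (Fin q × Fin n) (Fin q × Fin n) ℝ :=
  (Matrix.of fun _ _ => (q : ℝ)⁻¹) ⊗ₖ 1

theorem syncProj_mulVec (z : Fin q × Fin n → ℝ) (i : Fin q) (a : Fin n) :
    (syncProj q n *ᵥ z) (i, a) = (q : ℝ)⁻¹ * ∑ j, z (j, a) := by
  simp [syncProj, Matrix.mulVec, dotProduct, Fintype.sum_prod_type, Matrix.one_apply,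
    Finset.mul_sum]

theorem syncProj_transpose : (syncProj q n)ᵀ = syncProj q n := by
  ext ⟨i, a⟩ ⟨j, b⟩
  simp [syncProj, Matrix.one_apply, eq_comm]

theorem syncProj_mul_self (hq : q ≠ 0) : syncProj q n * syncProj q n = syncProj q n := by
  rw [syncProj, ← Matrix.mul_kronecker_mul, one_mul]
  congr 1
  ext i j
  simp [Matrix.mul_apply, hq]

theorem syncProj_posSemidef (hq : q ≠ 0) : (syncProj q n).PosSemidef := by
  have := Matrix.posSemidef_conjTranspose_mul_self (syncProj q n)
  rwa [Matrix.conjTranspose_eq_transpose_of_trivial, syncProj_transpose,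
    syncProj_mul_self hq] at this

theorem lap_mul_syncProj {W : Fin q → Fin q → Matrix (Fin n) (Fin n) ℝ} (hW : ∀ i, W i i = 0) :
    lap W * syncProj q n = 0 := by
  refine Matrix.ext_of_mulVec_single fun p => ?_
  rw [← Matrix.mulVec_mulVec, Matrix.zero_mulVec]
  ext ⟨i, a⟩
  rw [lap_mulVec hW]
  simp only [syncProj_mulVec, sub_self]
  simp [← Pi.zero_def]

theorem syncProj_mul_lap {W : Fin q → Fin q → Matrix (Fin n) (Fin n) ℝ} (hW : IsCoupling W) :
    syncProj q n * lap W = 0 := by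
  have h := congrArg Matrix.transpose (lap_mul_syncProj hW.diag)
  have h2 := (lap_isHermitian hW).eq
  rw [Matrix.conjTranspose_eq_transpose_of_trivial] at h2
  rwa [Matrix.transpose_mul, syncProj_transpose, h2, Matrix.transpose_zero] at h

theorem syncProj_mulVec_eq_self_iff (hq : q ≠ 0) {z : Fin q × Fin n → ℝ} :
    syncProj q n *ᵥ z = z ↔ ∀ i j a, z (i, a) = z (j, a) := by
  constructor
  · intro h i j a
    rw [← h, syncProj_mulVec, syncProj_mulVec]
  · intro h
    ext ⟨i, a⟩
    rw [syncProj_mulVec, Finset.sum_congr rfl fun j _ => h j i a]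
    simp [hq]

end Lap

/-! ### The array in normalized coordinates -/

section Oscillators

variable {q n : ℕ} {M K : Matrix (Fin n) (Fin n) ℝ}
  {D R : Fin q → Fin q → Matrix (Fin n) (Fin n) ℝ} {ε : ℝ}

open scoped MatrixOrder in
theorem exists_sqrt_mul_invSqrt (hM : M.PosDef) : ∃ s : Matrix (Fin n) (Fin n) ℝ,
    s * invSqrt M = 1 ∧ invSqrt M * s = 1 ∧ invSqrt M * M = s ∧ (invSqrt M).IsHermitian := by
  have h1 : CFC.sqrt M * CFC.sqrt M = M := CFC.sqrt_mul_sqrt_self M hM.posSemidef.nonneg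
  have h2 : (CFC.sqrt M).IsHermitian := (Matrix.nonneg_iff_posSemidef.1 (CFC.sqrt_nonneg M)).1
  have h3 : IsUnit (CFC.sqrt M).det := by
    have := hM.det_pos.ne'
    rw [← h1, Matrix.det_mul] at this
    exact (left_ne_zero_of_mul this).isUnit
  have h4 : invSqrt M * CFC.sqrt M = 1 := Matrix.nonsing_inv_mul _ h3
  refine ⟨CFC.sqrt M, Matrix.mul_nonsing_inv _ h3, h4, ?_, h2.inv⟩
  calc invSqrt M * M = invSqrt M * (CFC.sqrt M * CFC.sqrt M) := by rw [h1]
    _ = CFC.sqrt M := by rw [← mul_assoc, h4, one_mul]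

theorem oscP_posDef (hM : M.PosDef) (hK : K.PosDef) : (oscP M K).PosDef := by
  obtain ⟨s, h1, h2, -, h4⟩ := exists_sqrt_mul_invSqrt hM
  have h := hK.conjTranspose_mul_mul_same (B := invSqrt M) fun x y hxy => by
    have := congrArg (s *ᵥ ·) hxy
    simpa [Matrix.mulVec_mulVec, h1] using this
  rwa [h4.eq] at h

theorem couplingLap_posSemidef (hM : M.PosDef) (hD : IsCoupling D) :
    (couplingLap M D).PosSemidef := by
  obtain ⟨-, -, -, -, h4⟩ := exists_sqrt_mul_invSqrt hM
  exact lap_posSemidef (hD.conj h4)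

/-- The stiffness matrix `[I_q ⊗ P] + ε L_r` of the array in normalized coordinates. -/
noncomputable def stiffness (M K : Matrix (Fin n) (Fin n) ℝ)
    (R : Fin q → Fin q → Matrix (Fin n) (Fin n) ℝ) (ε : ℝ) :
    Matrix (Fin q × Fin n) (Fin q × Fin n) ℝ :=
  (1 : Matrix (Fin q) (Fin q) ℝ) ⊗ₖ oscP M K + ε • couplingLap M R

theorem stiffness_posDef (hM : M.PosDef) (hK : K.PosDef) (hR : IsCoupling R) (hε : 0 ≤ ε) :
    (stiffness M K R ε).PosDef :=
  (Matrix.PosDef.one.kronecker (oscP_posDef hM hK)).add_posSemidef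
    ((couplingLap_posSemidef hM hR).smul hε)

theorem stiffness_mul_syncProj (hM : M.PosDef) (hR : IsCoupling R) :
    stiffness M K R ε * syncProj q n = syncProj q n * stiffness M K R ε := by
  obtain ⟨-, -, -, -, h4⟩ := exists_sqrt_mul_invSqrt hM
  have hR' := hR.conj h4
  rw [stiffness, couplingLap, add_mul, mul_add, smul_mul_assoc, mul_smul_comm,
    lap_mul_syncProj hR'.diag, syncProj_mul_lap hR', syncProj, ← Matrix.mul_kronecker_mul,
    ← Matrix.mul_kronecker_mul, one_mul, mul_one, one_mul, mul_one]

theorem one_kronecker_mulVec (P : Matrix (Fin n) (Fin n) ℝ) (z : Fin q × Fin n → ℝ)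
    (i : Fin q) (a : Fin n) :
    (((1 : Matrix (Fin q) (Fin q) ℝ) ⊗ₖ P) *ᵥ z) (i, a) = (P *ᵥ fun b => z (i, b)) a := by
  simp [Matrix.mulVec, dotProduct, Fintype.sum_prod_type, Matrix.one_apply, ite_mul]

/-- With `s = M^{1/2}`, the residual of the normalized equation at `s p`, `s v`, `s a` is `M^{-1/2}`
times that of the original one. This transfers solutions in both directions. -/
theorem normalized_residual (hD : IsCoupling D) (hR : IsCoupling R)
    {s : Matrix (Fin n) (Fin n) ℝ} (h2 : invSqrt M * s = 1) (h3 : invSqrt M * M = s)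
    (h4 : (invSqrt M).IsHermitian) (p v a : Fin q → Fin n → ℝ) (i : Fin q) (b : Fin n) :
    ((fun r : Fin q × Fin n => (s *ᵥ a r.1) r.2)
      + couplingLap M D *ᵥ (fun r : Fin q × Fin n => (s *ᵥ v r.1) r.2)
      + stiffness M K R ε *ᵥ (fun r : Fin q × Fin n => (s *ᵥ p r.1) r.2)) (i, b) =
    (invSqrt M *ᵥ (M *ᵥ a i + K *ᵥ p i + ∑ j, D i j *ᵥ (v i - v j)
      + ε • ∑ j, R i j *ᵥ (p i - p j))) b := by
  have key {W : Fin q → Fin q → Matrix (Fin n) (Fin n) ℝ} (hW : IsCoupling W)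
      (p : Fin q → Fin n → ℝ) :
      (couplingLap M W *ᵥ (fun r : Fin q × Fin n => (s *ᵥ p r.1) r.2)) (i, b) =
      (invSqrt M *ᵥ ∑ j, W i j *ᵥ (p i - p j)) b := by
    rw [couplingLap, lap_mulVec (hW.conj h4).diag, Matrix.mulVec_sum, Finset.sum_apply]
    refine Finset.sum_congr rfl fun j _ => ?_
    have : (fun c => (s *ᵥ p i) c - (s *ᵥ p j) c) = s *ᵥ (p i - p j) := by
      rw [Matrix.mulVec_sub]; rfl
    simp only [this, Matrix.mulVec_mulVec, mul_assoc, h2, mul_one]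
  simp only [Pi.add_apply, stiffness, Matrix.add_mulVec, Matrix.smul_mulVec, Pi.smul_apply,
    key hD, key hR, one_kronecker_mulVec, Matrix.mulVec_add, Matrix.mulVec_smul]
  have hP : (oscP M K *ᵥ fun c => (s *ᵥ p i) c) = invSqrt M *ᵥ K *ᵥ p i := by
    rw [oscP, Matrix.mulVec_mulVec, Matrix.mulVec_mulVec, mul_assoc, h2, mul_one]
  rw [hP, Matrix.mulVec_mulVec (a i), h3]
  ring

theorem isSolution_of_isDampedMotion (hM : M.PosDef) (hD : IsCoupling D) (hR : IsCoupling R)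
    {z v a : ℝ → Fin q × Fin n → ℝ}
    (h : IsDampedMotion (stiffness M K R ε) (couplingLap M D) z v a) :
    IsSolution M K D R ε fun i t => invSqrt M *ᵥ fun b => z t (i, b) := by
  obtain ⟨s, h1, h2, h3, h4⟩ := exists_sqrt_mul_invSqrt hM
  have hcomp {f f' : ℝ → Fin q × Fin n → ℝ} (hf : ∀ t, HasDerivAt f (f' t) t) (i : Fin q)
      (t : ℝ) : HasDerivAt (fun t => invSqrt M *ᵥ fun b => f t (i, b))
        (invSqrt M *ᵥ fun b => f' t (i, b)) t :=
    (hasDerivAt_pi.2 fun b => hasDerivAt_pi.1 (hf t) (i, b)).matrix_mulVec _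
  refine ⟨_, _, hcomp h.hasDerivAt, hcomp h.hasDerivAt', fun i t => ?_⟩
  have hs (f : Fin q × Fin n → ℝ) : (fun r : Fin q × Fin n =>
      (s *ᵥ invSqrt M *ᵥ fun b => f (r.1, b)) r.2) = f := by
    simp only [Matrix.mulVec_mulVec, h1, Matrix.one_mulVec]
  have key := normalized_residual (K := K) (ε := ε) hD hR h2 h3 h4
    (fun i => invSqrt M *ᵥ fun b => z t (i, b)) (fun i => invSqrt M *ᵥ fun b => v t (i, b))
    (fun i => invSqrt M *ᵥ fun b => a t (i, b)) i
  simp only [hs, h.eq t] at key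
  have h0 := congrArg (s *ᵥ ·) (funext fun b => (key b).symm)
  simp only [Matrix.mulVec_mulVec, h1, Matrix.one_mulVec] at h0
  simp only [Matrix.mulVec_mulVec]
  rw [h0]
  simp [← Pi.zero_def]

theorem isDampedMotion_of_isSolution (hD : IsCoupling D) (hR : IsCoupling R)
    {s : Matrix (Fin n) (Fin n) ℝ} (h2 : invSqrt M * s = 1) (h3 : invSqrt M * M = s)
    (h4 : (invSqrt M).IsHermitian) {x : Fin q → ℝ → Fin n → ℝ} (h : IsSolution M K D R ε x) :
    ∃ v a, IsDampedMotion (stiffness M K R ε) (couplingLap M D)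
      (fun t (r : Fin q × Fin n) => (s *ᵥ x r.1 t) r.2) v a := by
  obtain ⟨v, a, hx, hv, heq⟩ := h
  refine ⟨fun t r => (s *ᵥ v r.1 t) r.2, fun t r => (s *ᵥ a r.1 t) r.2,
    fun t => hasDerivAt_pi.2 fun r => hasDerivAt_pi.1 ((hx r.1 t).matrix_mulVec s) r.2,
    fun t => hasDerivAt_pi.2 fun r => hasDerivAt_pi.1 ((hv r.1 t).matrix_mulVec s) r.2,
    fun t => ?_⟩
  ext ⟨i, b⟩
  rw [normalized_residual (p := fun i => x i t) (v := fun i => v i t) (a := fun i => a i t)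
    hD hR h2 h3 h4, heq i t, Matrix.mulVec_zero]
  rfl

theorem synchronous_of_synchronizes (hM : M.PosDef) (hK : K.PosDef) (hD : IsCoupling D)
    (hR : IsCoupling R) (hε : 0 ≤ ε) (h : Synchronizes M K D R ε) {w : Fin q × Fin n → ℝ} {c : ℝ}
    (hBw : couplingLap M D *ᵥ w = 0) (hAw : stiffness M K R ε *ᵥ w = c • w)
    (i j : Fin q) (a : Fin n) : w (i, a) = w (j, a) := by
  rcases eq_or_ne w 0 with rfl | hw
  · rfl
  have hc : 0 < c := by
    have h1 := (stiffness_posDef hM hK hR hε).dotProduct_mulVec_pos hw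
    rw [hAw, star_trivial, dotProduct_smul, smul_eq_mul] at h1
    have h2 : 0 ≤ w ⬝ᵥ w := by simpa using dotProduct_star_self_nonneg w
    exact pos_of_mul_pos_left h1 h2
  have hsol := isSolution_of_isDampedMotion hM hD hR (isDampedMotion_cos hc.le hBw hAw)
  have hlim := h _ hsol i j
  set d : Fin n → ℝ := (invSqrt M *ᵥ fun b => w (i, b)) - invSqrt M *ᵥ fun b => w (j, b) with hd
  have hfun (t : ℝ) : (invSqrt M *ᵥ fun b => (Real.cos (√c * t) • w) (i, b)) -
      (invSqrt M *ᵥ fun b => (Real.cos (√c * t) • w) (j, b)) = Real.cos (√c * t) • d := by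
    have (k : Fin q) : (fun b => (Real.cos (√c * t) • w) (k, b)) =
        Real.cos (√c * t) • fun b => w (k, b) := rfl
    rw [this, this, Matrix.mulVec_smul, Matrix.mulVec_smul, hd, smul_sub]
  simp only [hfun] at hlim
  have hsq : 0 < √c := Real.sqrt_pos.2 hc
  -- Sampling at full periods of the cosine makes the difference of the two blocks constant, so its
  -- limit zero forces it to vanish.
  have hseq : Tendsto (fun k : ℕ => (k : ℝ) * (2 * Real.pi / √c)) atTop atTop :=
    tendsto_natCast_atTop_atTop.atTop_mul_const (by positivity)
  have hconst := hlim.comp hseq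
  have hval (k : ℕ) : Real.cos (√c * ((k : ℝ) * (2 * Real.pi / √c))) = 1 := by
    rw [show √c * ((k : ℝ) * (2 * Real.pi / √c)) = k * (2 * Real.pi) by field_simp]
    exact Real.cos_nat_mul_two_pi k
  simp only [Function.comp_def, hval, one_smul] at hconst
  have hd0 : d = 0 := by
    simpa using tendsto_nhds_unique tendsto_const_nhds hconst
  obtain ⟨s, h1, -, -, -⟩ := exists_sqrt_mul_invSqrt hM
  have h5 := congrArg (s *ᵥ ·) hd0
  simp only [hd, Matrix.mulVec_sub, Matrix.mulVec_mulVec, h1, Matrix.one_mulVec,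
    Matrix.mulVec_zero] at h5
  exact sub_eq_zero.1 (congrFun h5 a)

theorem synchronizes_iff (hq : q ≠ 0) (hM : M.PosDef) (hK : K.PosDef) (hD : IsCoupling D)
    (hR : IsCoupling R) (hε : 0 ≤ ε) : Synchronizes M K D R ε ↔
      ∀ (w : Fin q × Fin n → ℝ) (c : ℝ), couplingLap M D *ᵥ w = 0 →
        stiffness M K R ε *ᵥ w = c • w → ∀ i j a, w (i, a) = w (j, a) := by
  refine ⟨fun h w c hB hA => synchronous_of_synchronizes hM hK hD hR hε h hB hA,
    fun h x hx i j => ?_⟩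
  obtain ⟨s, h1, h2, h3, h4⟩ := exists_sqrt_mul_invSqrt hM
  obtain ⟨v, a, hz⟩ := isDampedMotion_of_isSolution hD hR h2 h3 h4 hx
  have hlim := hz.tendsto_sub_proj (stiffness_posDef hM hK hR hε) (couplingLap_posSemidef hM hD)
    (syncProj_posSemidef hq) (syncProj_mul_self hq) (stiffness_mul_syncProj hM hR)
    (lap_mul_syncProj (hD.conj h4).diag) (syncProj_mul_lap (hD.conj h4))
    fun w c hB hA => (syncProj_mulVec_eq_self_iff hq).2 (h w c hB hA)
  rw [tendsto_pi_nhds] at hlim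
  have hsub : Tendsto (fun t => s *ᵥ (x i t - x j t)) atTop (𝓝 0) := by
    rw [tendsto_pi_nhds]
    intro b
    have := (hlim (i, b)).sub (hlim (j, b))
    simp only [Matrix.sub_mulVec, Matrix.one_mulVec, Pi.sub_apply, syncProj_mulVec,
      sub_sub_sub_cancel_right, Pi.zero_apply, sub_zero] at this
    simpa [Matrix.mulVec_sub] using this
  have hcont : Continuous fun y : Fin n → ℝ => ‖WithLp.toLp 2 (invSqrt M *ᵥ y)‖ := by fun_prop
  have := (hcont.tendsto 0).comp hsub
  simpa [Function.comp_def, Matrix.mulVec_mulVec, h2] using this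

end Oscillators

/-! ### Modal coordinates and the synchronous space -/

section Modal

variable {q n : ℕ}

theorem orthonormal_of_eigenvectors {P : Matrix (Fin n) (Fin n) ℝ} (hP : P.IsHermitian)
    {σ : Fin n → ℝ} (hσ : Function.Injective σ) {v : Fin n → Fin n → ℝ}
    (hv_unit : ∀ k, v k ⬝ᵥ v k = 1) (hv : ∀ k, P *ᵥ v k = σ k • v k) :
    Matrix.of v * (Matrix.of v)ᵀ = 1 := by
  ext k l
  have hkl : (Matrix.of v * (Matrix.of v)ᵀ) k l = v k ⬝ᵥ v l := rfl
  rw [hkl, Matrix.one_apply]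
  split_ifs with h
  · rw [h, hv_unit]
  · have h1 : σ l * (v k ⬝ᵥ v l) = σ k * (v k ⬝ᵥ v l) := by
      rw [← smul_eq_mul, ← dotProduct_smul, ← hv, Matrix.dotProduct_mulVec,
        ← Matrix.mulVec_transpose, ← Matrix.conjTranspose_eq_transpose_of_trivial, hP.eq, hv,
        smul_dotProduct, smul_eq_mul]
    by_contra h0
    exact h (hσ (mul_right_cancel₀ h0 h1)).symm

theorem simMat_apply (v : Fin n → Fin n → ℝ) (i : Fin q) (a : Fin n) (k : Fin n) (j : Fin q) :
    simMat q v (i, a) (k, j) = if i = j then v k a else 0 := by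
  simp [simMat, swapMat, Matrix.mul_apply, Matrix.one_apply]

theorem simMat_transpose_mul_one_kronecker_mul (v : Fin n → Fin n → ℝ)
    (P : Matrix (Fin n) (Fin n) ℝ) :
    (simMat q v)ᵀ * ((1 : Matrix (Fin q) (Fin q) ℝ) ⊗ₖ P) * simMat q v =
      (Matrix.of v * P * (Matrix.of v)ᵀ) ⊗ₖ (1 : Matrix (Fin q) (Fin q) ℝ) := by
  rw [← swapMat_transpose_mul_kronecker_mul (q := q) (n := n), simMat, Matrix.transpose_mul,
    ← Matrix.kroneckerMap_transpose, Matrix.transpose_one, Matrix.transpose_transpose]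
  have : (1 : Matrix (Fin q) (Fin q) ℝ) ⊗ₖ (Matrix.of v * P * (Matrix.of v)ᵀ) =
      (1 ⊗ₖ Matrix.of v) * (1 ⊗ₖ P) * (1 ⊗ₖ (Matrix.of v)ᵀ) := by
    rw [← Matrix.mul_kronecker_mul, ← Matrix.mul_kronecker_mul, one_mul, one_mul]
  rw [this]
  simp only [Matrix.mul_assoc]

theorem simMat_transpose_mul_self {v : Fin n → Fin n → ℝ}
    (hv : Matrix.of v * (Matrix.of v)ᵀ = 1) : (simMat q v)ᵀ * simMat q v = 1 := by
  have h := simMat_transpose_mul_one_kronecker_mul (q := q) v 1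
  simpa [hv] using h

theorem simMat_mul_transpose {v : Fin n → Fin n → ℝ}
    (hv : Matrix.of v * (Matrix.of v)ᵀ = 1) : simMat q v * (simMat q v)ᵀ = 1 :=
  (Matrix.mul_eq_one_comm_of_card_eq _ _ _ (by simp [mul_comm])).1 (simMat_transpose_mul_self hv)

theorem modalMatrix_eq (v : Fin n → Fin n → ℝ) (L : Matrix (Fin q × Fin n) (Fin q × Fin n) ℝ) :
    modalMatrix v L = (simMat q v)ᵀ * L * simMat q v := by
  ext ⟨k, i⟩ ⟨l, j⟩
  simp [modalMatrix, modalBlock, Matrix.mul_apply, simMat_apply, Fintype.sum_prod_type,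
    Matrix.one_apply, ite_mul, Finset.sum_ite_eq]

theorem diagonal_of_eigenvectors {P : Matrix (Fin n) (Fin n) ℝ} {σ : Fin n → ℝ}
    {v : Fin n → Fin n → ℝ} (hv : ∀ k, P *ᵥ v k = σ k • v k)
    (hV : Matrix.of v * (Matrix.of v)ᵀ = 1) :
    Matrix.of v * P * (Matrix.of v)ᵀ = Matrix.diagonal σ := by
  have : P * (Matrix.of v)ᵀ = (Matrix.of v)ᵀ * Matrix.diagonal σ := by
    ext a k
    rw [Matrix.mul_diagonal]
    have := congrFun (hv k) a
    simpa [Matrix.mulVec, dotProduct, Matrix.mul_apply, mul_comm] using this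
  rw [mul_assoc, this, ← mul_assoc, hV, one_mul]

theorem toComplex_conj {ι κ : Type*} [Fintype ι] [Fintype κ] (S : Matrix ι κ ℝ)
    (X Y : Matrix ι ι ℝ) : toComplex (Sᵀ * X * S) (Sᵀ * Y * S) =
      Sᵀ.map Complex.ofReal * toComplex X Y * S.map Complex.ofReal := by
  have h (Z : Matrix ι ι ℝ) : (Sᵀ * Z * S).map Complex.ofReal =
      Sᵀ.map Complex.ofReal * Z.map Complex.ofReal * S.map Complex.ofReal := by
    have h1 : (Sᵀ * Z * S).map Complex.ofRealHom =
      (Sᵀ * Z).map Complex.ofRealHom * S.map Complex.ofRealHom := Matrix.map_mul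
    have h2 : (Sᵀ * Z).map Complex.ofRealHom =
      Sᵀ.map Complex.ofRealHom * Z.map Complex.ofRealHom := Matrix.map_mul
    rw [h2] at h1
    exact h1
  rw [toComplex, toComplex, h, h, Matrix.mul_add, Matrix.add_mul, Matrix.mul_smul,
    Matrix.smul_mul]

theorem Omg_eq_conj_Gam {M K : Matrix (Fin n) (Fin n) ℝ}
    (D R : Fin q → Fin q → Matrix (Fin n) (Fin n) ℝ) (ε : ℝ) {σ : Fin n → ℝ}
    {v : Fin n → Fin n → ℝ} (hv : ∀ k, oscP M K *ᵥ v k = σ k • v k)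
    (hV : Matrix.of v * (Matrix.of v)ᵀ = 1) :
    Omg M D R ε σ v = (simMat q v)ᵀ.map Complex.ofReal * Gam M K D R ε *
      (simMat q v).map Complex.ofReal := by
  rw [Gam, ← toComplex_conj, Omg, modalMatrix_eq, modalMatrix_eq, Matrix.mul_add,
    Matrix.add_mul, simMat_transpose_mul_one_kronecker_mul, diagonal_of_eigenvectors hv hV,
    Matrix.mul_smul, Matrix.smul_mul]

/-- Swapping the factors `T X` and `S` changes the characteristic polynomial only by powers of the
variable, and these cancel because the index types have equal size. -/
theorem charpoly_conj_eq {ι κ : Type*} [Fintype ι] [DecidableEq ι] [Fintype κ] [DecidableEq κ]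
    {S : Matrix ι κ ℂ} {T : Matrix κ ι ℂ} (h : S * T = 1) (hcard : Fintype.card ι = Fintype.card κ)
    (X : Matrix ι ι ℂ) : (T * X * S).charpoly = X.charpoly := by
  have h1 := Matrix.charpoly_mul_comm' (T * X) S
  rw [hcard, ← Matrix.mul_assoc, h, Matrix.one_mul] at h1
  exact mul_left_cancel₀ (pow_ne_zero _ Polynomial.X_ne_zero) h1

/-- The space of synchronous complex states. -/
noncomputable def syncSpace (q n : ℕ) : Submodule ℂ (Fin q × Fin n → ℂ) :=
  LinearMap.range (LinearMap.funLeft ℂ ℂ (Prod.snd : Fin q × Fin n → Fin n))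

theorem finrank_syncSpace (hq : q ≠ 0) : Module.finrank ℂ (syncSpace q n) = n := by
  have : Nonempty (Fin q) := ⟨⟨0, Nat.pos_of_ne_zero hq⟩⟩
  rw [syncSpace, LinearMap.finrank_range_of_inj
    (LinearMap.funLeft_injective_of_surjective _ _ _ Prod.snd_surjective), Module.finrank_fin_fun]

theorem mem_syncSpace_iff (hq : q ≠ 0) {w : Fin q × Fin n → ℂ} :
    w ∈ syncSpace q n ↔ ∀ i j a, w (i, a) = w (j, a) := by
  constructor
  · rintro ⟨y, rfl⟩ i j a
    rfl
  · intro h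
    refine ⟨fun a => w (⟨0, Nat.pos_of_ne_zero hq⟩, a), ?_⟩
    ext ⟨i, a⟩
    exact h _ _ _

theorem couplingLap_mulVec_synchronous {M : Matrix (Fin n) (Fin n) ℝ}
    {W : Fin q → Fin q → Matrix (Fin n) (Fin n) ℝ} (hW : IsCoupling W) (y : Fin n → ℝ) :
    couplingLap M W *ᵥ (fun r => y r.2) = 0 := by
  ext ⟨i, a⟩
  rw [couplingLap, lap_mulVec fun i => by simp [hW.diag]]
  simp [← Pi.zero_def]

/-- Both Laplacians annihilate synchronous states, so each `v k` copied into every block is an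
undamped mode with eigenvalue `σ k`. Orthogonality of `V` makes these copies span the synchronous
space. -/
theorem syncSpace_le_undampedSpace {M K : Matrix (Fin n) (Fin n) ℝ}
    {D R : Fin q → Fin q → Matrix (Fin n) (Fin n) ℝ} (hD : IsCoupling D) (hR : IsCoupling R)
    {ε : ℝ} {σ : Fin n → ℝ} {v : Fin n → Fin n → ℝ} (hv : ∀ k, oscP M K *ᵥ v k = σ k • v k)
    (hV : Matrix.of v * (Matrix.of v)ᵀ = 1) :
    syncSpace q n ≤ undampedSpace ((stiffness M K R ε).map Complex.ofReal)
      ((couplingLap M D).map Complex.ofReal) := by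
  have hmode (k : Fin n) : (fun r : Fin q × Fin n => (v k r.2 : ℂ)) ∈ undampedSpace
      ((stiffness M K R ε).map Complex.ofReal) ((couplingLap M D).map Complex.ofReal) := by
    refine mem_undampedSpace (c := σ k) ?_ ?_
    · rw [Matrix.map_ofReal_mulVec _ fun r : Fin q × Fin n => v k r.2,
        couplingLap_mulVec_synchronous hD]
      ext; simp
    · rw [Matrix.map_ofReal_mulVec _ fun r : Fin q × Fin n => v k r.2, stiffness,
        Matrix.add_mulVec, Matrix.smul_mulVec, couplingLap_mulVec_synchronous hR]
      ext ⟨i, a⟩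
      simp [one_kronecker_mulVec, hv]
  rintro _ ⟨y, rfl⟩
  have hV' : (Matrix.of v)ᵀ * Matrix.of v = 1 := mul_eq_one_comm.1 hV
  have hy : LinearMap.funLeft ℂ ℂ (Prod.snd : Fin q × Fin n → Fin n) y =
      ∑ k, (∑ b, (v k b : ℂ) * y b) • fun r : Fin q × Fin n => (v k r.2 : ℂ) := by
    ext ⟨i, a⟩
    have h (b : Fin n) : ∑ k, (v k b : ℂ) * v k a = if a = b then 1 else 0 := by
      have := congrFun (congrFun hV' a) b
      rw [Matrix.mul_apply, Matrix.one_apply] at this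
      simp only [Matrix.transpose_apply, Matrix.of_apply] at this
      have h2 := congrArg Complex.ofReal this
      push_cast at h2
      rw [← Finset.sum_congr rfl fun k _ => mul_comm _ _, h2]
      split_ifs <;> simp
    simp only [LinearMap.funLeft_apply, Finset.sum_apply, Pi.smul_apply, smul_eq_mul,
      Finset.sum_mul]
    rw [Finset.sum_comm]
    have h3 (b : Fin n) : ∑ k, (v k b : ℂ) * y b * v k a = y b * if a = b then 1 else 0 := by
      rw [← h, Finset.mul_sum]
      exact Finset.sum_congr rfl fun k _ => by ring
    simp [h3]
  rw [hy]
  exact Submodule.sum_mem _ fun k _ => Submodule.smul_mem _ _ (hmode k)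

theorem forall_mem_syncSpace_iff (hq : q ≠ 0)
    {A B : Matrix (Fin q × Fin n) (Fin q × Fin n) ℝ} (hA : A.PosSemidef) :
    (∀ (w : Fin q × Fin n → ℂ) (c : ℂ), B.map Complex.ofReal *ᵥ w = 0 →
        A.map Complex.ofReal *ᵥ w = c • w → w ∈ syncSpace q n) ↔
      ∀ (w : Fin q × Fin n → ℝ) (c : ℝ), B *ᵥ w = 0 → A *ᵥ w = c • w →
        ∀ i j a, w (i, a) = w (j, a) := by
  simp only [mem_syncSpace_iff hq]
  constructor
  · intro h w c hB hw i j a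
    have := h (fun r => (w r : ℂ)) c
      (by rw [Matrix.map_ofReal_mulVec, hB]; ext; simp)
      (by rw [Matrix.map_ofReal_mulVec, hw]; ext; simp) i j a
    exact_mod_cast this
  · intro h w c hB hw i j a
    obtain ⟨d, h1, h2⟩ := exists_re_im_eigenvector hA hB hw
    exact Complex.ext (h _ d h1.1 h1.2 i j a) (h _ d h2.1 h2.2 i j a)

theorem synchronizes_iff_reLambda_Gam (hq : 2 ≤ q) (hn : 1 ≤ n) {M K : Matrix (Fin n) (Fin n) ℝ}
    (hM : M.PosDef) (hK : K.PosDef) {D R : Fin q → Fin q → Matrix (Fin n) (Fin n) ℝ}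
    (hD : IsCoupling D) (hR : IsCoupling R) {σ : Fin n → ℝ} {v : Fin n → Fin n → ℝ}
    (hv : ∀ k, oscP M K *ᵥ v k = σ k • v k) (hV : Matrix.of v * (Matrix.of v)ᵀ = 1)
    {ε : ℝ} (hε : 0 ≤ ε) :
    Synchronizes M K D R ε ↔ 0 < reLambda (n + 1) (Gam M K D R ε) := by
  have hq0 : q ≠ 0 := by omega
  have hA := stiffness_posDef hM hK hR hε
  have hB := couplingLap_posSemidef hM hD
  -- Since `q ≥ 2` and `n ≥ 1`, `n < q n`, so an eigenvalue with index `n + 1` exists.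
  have hcard : Module.finrank ℂ (syncSpace q n) < Fintype.card (Fin q × Fin n) := by
    rw [finrank_syncSpace hq0, Fintype.card_prod, Fintype.card_fin, Fintype.card_fin]
    nlinarith
  have key := zero_lt_reLambda_iff_forall_mem hA.posSemidef.map_ofReal hB.map_ofReal
    (syncSpace_le_undampedSpace hD hR hv hV) hcard
  rw [finrank_syncSpace hq0, forall_mem_syncSpace_iff hq0 hA.posSemidef] at key
  rw [synchronizes_iff hq0 hM hK hD hR hε]
  exact key.symm

end Modal

end

/-! ### The main theorem -/

theorem mainTheorem7 {q n : ℕ} (hq : 2 ≤ q) (hn : 1 ≤ n)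
    (M K : Matrix (Fin n) (Fin n) ℝ) (hM : M.PosDef) (hK : K.PosDef)
    (D R : Fin q → Fin q → Matrix (Fin n) (Fin n) ℝ) (hD : IsCoupling D) (hR : IsCoupling R)
    (σ : Fin n → ℝ) (hσ : ∀ s : ℝ, (s • M - K).det = 0 ↔ ∃ k, σ k = s)
    (hσ_inj : Function.Injective σ)
    (v : Fin n → Fin n → ℝ) (hv_unit : ∀ k, v k ⬝ᵥ v k = 1)
    (hv : ∀ k, oscP M K *ᵥ v k = σ k • v k)
    (ε : ℝ) (hε : 0 ≤ ε) :
    (Synchronizes M K D R ε ↔ 0 < reLambda (n + 1) (Omg M D R ε σ v)) ∧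
    (simMat q v)ᵀ * simMat q v = 1 ∧ simMat q v * (simMat q v)ᵀ = 1 ∧
    Omg M D R ε σ v = (simMat q v)ᵀ.map Complex.ofReal * Gam M K D R ε *
      (simMat q v).map Complex.ofReal := by
  have hV := orthonormal_of_eigenvectors (oscP_posDef hM hK).isHermitian hσ_inj hv_unit hv
  have hΩ := Omg_eq_conj_Gam (q := q) D R ε hv hV
  refine ⟨?_, simMat_transpose_mul_self hV, simMat_mul_transpose hV, hΩ⟩
  have hS : (simMat q v).map Complex.ofReal * (simMat q v)ᵀ.map Complex.ofReal = 1 := by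
    have h1 : (simMat q v * (simMat q v)ᵀ).map Complex.ofRealHom =
      (simMat q v).map Complex.ofRealHom * (simMat q v)ᵀ.map Complex.ofRealHom := Matrix.map_mul
    rw [simMat_mul_transpose hV, Matrix.map_one _ (map_zero _) (map_one _)] at h1
    exact h1.symm
  have hΓ : reLambda (n + 1) (Omg M D R ε σ v) = reLambda (n + 1) (Gam M K D R ε) := by
    rw [reLambda, reLambda, hΩ, charpoly_conj_eq hS (by simp [mul_comm])]
  rw [hΓ]
  exact synchronizes_iff_reLambda_Gam hq hn hM hK hD hR hv hV hε
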